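/- Let $m\ge 1$ and consider the control system $$y_t=f(\theta,\varphi_{t-1})+f'(u_{t-1},\varphi_{t-1})+w_t,\qquad t\ge 1,\qquad \varphi_t=(y_t,\dots,y_{t-m+1})\in\mathbb R^{pm},$$ with outputs $y_t\in\mathbb R^p$, inputs $u_t\in\mathbb R^r$ and an unknown non-random parameter $\theta$ in a known nondegenerate compact hyperrectangle $\Theta\subset\mathbb R^n$. Norms are Euclidean, $B(z,d)$ is the open ball and $\overline{B(z,d)}$ the closed ball. Assume: (A1) $\{w_t\}_{t\ge1}$ is an i.i.d. sequence such that, for each $t\ge1$, $w_t$ is independent of the past, i.e. of the $\sigma$-algebra generated by $\varphi_0$, $u_0,\dots,u_{t-1}$ and $w_1,\dots,w_{t-1}$; moreover, for some finite $C_w>0$, $\|w_1\|\le C_w$ a.s. and $\inf_{z\in\overline{B(0,C_w)}}P(w_1\in B(z,\delta))>0$ for all $\delta>0$. (A2) $f:\mathbb R^n\times\mathbb R^{pm}\to\mathbb R^p$ and $f':\mathbb R^r\times\mathbb R^{pm}\to\mathbb R^p$ are continuous. Let $(\varphi_0,\{u_t\}_{t\ge0})$ be an experiment with $\|u_t\|\le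 C_u$ a.s. for $t\ge1$, where $C_u>0$, and with $P\{\|\varphi_t\|\le C \text{ infinitely often}\}=1$ for some $C>0$. Since inputs may be generated by feedback, the experiment may depend on the true parameter; these conditions, with the same $C_u$ and $C$, are required for every value of the true parameter in $\Theta$. Then there is a constant $C_0>0$ such that, for every value $\theta\in\Theta$ of the true parameter, almost surely, for all $t\ge1$, $$\|\varphi_t\|\le C\ \Longrightarrow\ \|f(\theta,\varphi_i)+f'(u_i,\varphi_i)\|\le C_0,\quad i=t,\dots,t+m-1. \tag{1}$$ Let $C_0>0$ be any constant with property (1), and put $\mathcal S=\prod_{j=1}^m\overline{B(0,C_0)}\subset\mathbb R^{pm}$. If for all $x\ne x'$ in $\Theta$ $$\underline d^m\big(\{\beta\in\mathbb R^{pm}: f(x,\beta)\ne f(x',\beta)\}\,\big|\,\mathcal S\big)>\frac1{C_w},$$ then the system is identifiable under the experiment. Here, for $Z,Z'\subset\mathbb R^p$, $\underline d(Z'|Z)=1/\sup_{z\in Z}\inf\{d>0:B(z,d)\cap Z'\neq\emptyset\}\in[0,\infty]$ (with $\inf\emptyset=\infty$, $1/\infty=0$, $1/0=\infty$), and for $Z=\prod_{j=1}^mZ_j$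 with $Z_j\subset\mathbb R^p$ and $Z'\subset\mathbb R^{pm}$, $\underline d^m(Z'|Z)=\sup\{\min_{1\le j\le m}\underline d(E_j|Z_j): E_j\subset\mathbb R^p,\ \prod_{j=1}^mE_j\subset Z'\}$. The system is identifiable under the experiment if there is an estimator, i.e. a sequence of measurable functions $\hat\theta_t=\hat\theta_t(y_1,u_0,\dots,y_t,u_{t-1})$ not depending on $\theta$, such that $\hat\theta_t\to\theta$ almost surely for every value $\theta\in\Theta$ of the true parameter; so $\theta$ is determined by the data $\{y_{t+1},u_t\}_{t\ge0}$ with probability $1$. -/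

import Mathlib

open MeasureTheory ProbabilityTheory Filter Topology
open scoped ENNReal

noncomputable section

namespace ControlSystem

/-- The Euclidean space `ℝ^k`. -/
abbrev Vec (k : ℕ) : Type := EuclideanSpace ℝ (Fin k)

/-- Regressors `(z_1, …, z_m)` with `z_j ∈ ℝ^p`, i.e. `ℝ^{pm}` with its Euclidean norm. -/
abbrev Regressor (p m : ℕ) : Type := PiLp 2 (fun _ : Fin m => Vec p)

/-- The regressor `(y, z_1, …, z_{m-1})` obtained from `(z_1, …, z_m)` when the new output `y`
arrives. -/
def push {p m : ℕ} (y : Vec p) (φ : Regressor p m) : Regressor p m :=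
  WithLp.toLp 2 fun j : Fin m =>
    if (j : ℕ) = 0 then y else φ ⟨(j : ℕ) - 1, lt_of_le_of_lt (Nat.sub_le _ _) j.isLt⟩

/-- The regressor `φ_t = (y_t, …, y_{t-m+1})` of the system
`y_t = f(θ, φ_{t-1}) + f'(u_{t-1}, φ_{t-1}) + w_t`, `t ≥ 1`, started at `φ_0`
(the value `w 0` plays no role). -/
def regressor {n r p m : ℕ} (f : Vec n → Regressor p m → Vec p)
    (f' : Vec r → Regressor p m → Vec p) (θ : Vec n) (φ₀ : Regressor p m)
    (u : ℕ → Vec r) (w : ℕ → Vec p) : ℕ → Regressor p m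
  | 0 => φ₀
  | t + 1 =>
    push (f θ (regressor f f' θ φ₀ u w t) + f' (u t) (regressor f f' θ φ₀ u w t) + w (t + 1))
      (regressor f f' θ φ₀ u w t)

/-- An experiment `(φ_0, {u_t}_{t ≥ 0})`: a random initial regressor and random inputs. -/
structure Experiment (Ω : Type*) (r p m : ℕ) where
  init : Ω → Regressor p m
  input : ℕ → Ω → Vec r

section Trajectories

variable {Ω : Type*} {n r p m : ℕ}

/-- `φ_t` along the experiment `e`, when the true parameter is `θ`. -/
def phi (f : Vec n → Regressor p m → Vec p) (f' : Vec r → Regressor p m → Vec p)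
    (θ : Vec n) (e : Experiment Ω r p m) (w : ℕ → Ω → Vec p) (t : ℕ) (ω : Ω) : Regressor p m :=
  regressor f f' θ (e.init ω) (fun s => e.input s ω) (fun s => w s ω) t

/-- The noise-free part `f(θ, φ_t) + f'(u_t, φ_t)` of `y_{t+1}`. -/
def drift (f : Vec n → Regressor p m → Vec p) (f' : Vec r → Regressor p m → Vec p)
    (θ : Vec n) (e : Experiment Ω r p m) (w : ℕ → Ω → Vec p) (t : ℕ) (ω : Ω) : Vec p :=
  f θ (phi f f' θ e w t ω) + f' (e.input t ω) (phi f f' θ e w t ω)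

/-- The first `t` data `(y_{s+1}, u_s)`, `0 ≤ s < t`. -/
def data (f : Vec n → Regressor p m → Vec p) (f' : Vec r → Regressor p m → Vec p)
    (θ : Vec n) (e : Experiment Ω r p m) (w : ℕ → Ω → Vec p) (t : ℕ) (ω : Ω) :
    Fin t → Vec p × Vec r :=
  fun s => (drift f f' θ e w s ω + w (s + 1) ω, e.input s ω)

/-- The σ-algebra of the past before `w_t` acts, generated by
`φ_0`, `u_0, …, u_{t-1}` and `w_1, …, w_{t-1}`. -/
@[reducible] def past (e : Experiment Ω r p m) (w : ℕ → Ω → Vec p) (t : ℕ) : MeasurableSpace Ω :=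
  MeasurableSpace.comap e.init inferInstance ⊔
    (⨆ i : ℕ, ⨆ _ : i < t, MeasurableSpace.comap (e.input i) inferInstance) ⊔
    (⨆ i : ℕ, ⨆ _ : 1 ≤ i ∧ i < t, MeasurableSpace.comap (w i) inferInstance)

end Trajectories

section Probability

variable {Ω : Type*} [MeasurableSpace Ω] {n r p m : ℕ}

/-- The experiment consists of random variables, with `‖u_t‖ ≤ C_u` a.s. for `t ≥ 1`. -/
structure Admissible (P : Measure Ω) (Cu : ℝ) (e : Experiment Ω r p m) : Prop where
  measurable_init : Measurable e.init
  measurable_input : ∀ t, Measurable (e.input t)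
  bounded : ∀ t, 1 ≤ t → ∀ᵐ ω ∂P, ‖e.input t ω‖ ≤ Cu

/-- `{w_t}_{t ≥ 1}` is i.i.d., bounded by `C_w`, and its common law charges the balls of any fixed
radius with centre in the closed ball of radius `C_w` uniformly. -/
structure Noise (P : Measure Ω) (Cw : ℝ) (w : ℕ → Ω → Vec p) : Prop where
  measurable : ∀ t, 1 ≤ t → Measurable (w t)
  indep : iIndepFun (fun t : ℕ => w (t + 1)) P
  identDistrib : ∀ t, 1 ≤ t → IdentDistrib (w t) (w 1) P P
  bounded : ∀ᵐ ω ∂P, ‖w 1 ω‖ ≤ Cw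
  charges : ∀ δ : ℝ, 0 < δ →
    0 < ⨅ z ∈ Metric.closedBall (0 : Vec p) Cw, P (w 1 ⁻¹' Metric.ball z δ)

/-- For each `t ≥ 1`, the noise `w_t` is independent of the past. -/
def IndepOfPast (P : Measure Ω) (e : Experiment Ω r p m) (w : ℕ → Ω → Vec p) : Prop :=
  ∀ t, 1 ≤ t → Indep (MeasurableSpace.comap (w t) inferInstance) (past e w t) P

/-- `P{‖φ_t‖ ≤ C i.o.} = 1`. -/
def Recurrent (P : Measure Ω) (f : Vec n → Regressor p m → Vec p)
    (f' : Vec r → Regressor p m → Vec p) (θ : Vec n) (e : Experiment Ω r p m)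
    (w : ℕ → Ω → Vec p) (C : ℝ) : Prop :=
  ∀ᵐ ω ∂P, ∃ᶠ t in atTop, ‖phi f f' θ e w t ω‖ ≤ C

/-- Almost surely, `‖φ_t‖ ≤ C` with `t ≥ 1` forces `‖f(θ, φ_i) + f'(u_i, φ_i)‖ ≤ C₀` for
`i = t, …, t + m - 1`. -/
def DriftBound (P : Measure Ω) (f : Vec n → Regressor p m → Vec p)
    (f' : Vec r → Regressor p m → Vec p) (θ : Vec n) (e : Experiment Ω r p m)
    (w : ℕ → Ω → Vec p) (C C₀ : ℝ) : Prop :=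
  ∀ᵐ ω ∂P, ∀ t, 1 ≤ t → ‖phi f f' θ e w t ω‖ ≤ C →
    ∀ i, t ≤ i → i < t + m → ‖drift f f' θ e w i ω‖ ≤ C₀

/-- Identifiability: one estimator, i.e. one sequence of measurable functions of the data
`(y_1, u_0), …, (y_t, u_{t-1})`, recovers almost surely in the limit whichever `θ ∈ Θ` is the
true parameter. As inputs may be generated by feedback, the experiment that is carried out may
depend on the true parameter: `e θ` is its realization when this parameter is `θ`. The estimator
does not see `θ`, `φ_0` or the noise. -/
def Identifiable (P : Measure Ω) (Θ : Set (Vec n)) (f : Vec n → Regressor p m → Vec p)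
    (f' : Vec r → Regressor p m → Vec p) (e : Vec n → Experiment Ω r p m)
    (w : ℕ → Ω → Vec p) : Prop :=
  ∃ est : (t : ℕ) → (Fin t → Vec p × Vec r) → Vec n,
    (∀ t, Measurable (est t)) ∧
    ∀ θ ∈ Θ, ∀ᵐ ω ∂P,
      Tendsto (fun t => est t (data f f' θ (e θ) w t ω)) atTop (𝓝 θ)

end Probability

/-- The hyperrectangle `∏ [a_i, b_i]` in `ℝ^n`. -/
def hyperrectangle {n : ℕ} (a b : Fin n → ℝ) : Set (Vec n) :=
  {x | ∀ i, a i ≤ x i ∧ x i ≤ b i}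

/-- The points at which the parameters `x` and `x'` give different values of `f`. -/
def excitationSet {n p m : ℕ} (f : Vec n → Regressor p m → Vec p) (x x' : Vec n) :
    Set (Regressor p m) :=
  {β | f x β ≠ f x' β}

/-- The lower density `1 / sup_{z ∈ Z} inf {d > 0 : B(z, d) ∩ Z' ≠ ∅}` of `Z'` in `Z`, with
values in `[0, ∞]`. -/
def lowerDensity {l : ℕ} (Z' Z : Set (Vec l)) : ℝ≥0∞ :=
  (⨆ z ∈ Z, ⨅ (d : ℝ) (_ : 0 < d ∧ (Metric.ball z d ∩ Z').Nonempty), ENNReal.ofReal d)⁻¹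

/-- The `m`-symmetric lower density of `Z'` in `∏ Z_j`: the supremum, over all products
`∏ E_j ⊆ Z'`, of the least of the lower densities of `E_j` in `Z_j`. -/
def symLowerDensity {l m : ℕ} (Z' : Set (Regressor l m)) (Z : Fin m → Set (Vec l)) : ℝ≥0∞ :=
  ⨆ (E : Fin m → Set (Vec l)) (_ : {η : Regressor l m | ∀ j, η j ∈ E j} ⊆ Z'),
    ⨅ j, lowerDensity (E j) (Z j)

end ControlSystem

end

/-! The estimator rests on refutation: a parameter x is refuted once a one-step prediction error for
x exceeds C_w in norm. That error is w_{s+1} + f(θ, φ_s) - f(x, φ_s), so almost surely θ is never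
refuted, and the task is to refute every other x in finite time.

Refutation needs φ_s near a point where f(θ, ·) and f(x, ·) differ. The density condition yields a
product of finite sets F_j inside the excitation set, each F_j within less than C_w of every point
of the ball of radius C₀ (`exists_finite_of_lt_lowerDensity`). During the m steps after a visit to
the ball of radius C the drift stays in that larger ball, so at each step some admissible noise
value moves the output onto the prescribed F_j. Noise near that value has conditional probability
bounded below, and conditional Borel–Cantelli (`ae_frequently_inter_of_indep`), applied once per
step, makes all m moves succeed infinitely often (`ae_frequently_outputs_near`).

One more noise value, near the extreme point of the noise ball in the direction of f(θ, φ_s) - f(x,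
φ_s), then drives the error beyond C_w (`lt_norm_add_of_near_extreme`). By continuity it refutes a
whole neighbourhood of x (`exists_nhds_ae_exists_lt`), and a countable subcover gives one null set
for all x. Compactness turns refutation into convergence (`exists_measurable_tendsto_of_loss`). -/

namespace ControlSystem

/-! ### Conditional Borel–Cantelli and measurable near-minimizers -/

section General

/-- A frequently satisfied choice among finitely many alternatives has an alternative that is
chosen frequently. -/
theorem exists_mem_frequently_of_frequently_exists_mem {α ι : Type*} {l : Filter α}
    {I : Set ι} (hI : I.Finite) {q : ι → α → Prop} (h : ∃ᶠ x in l, ∃ i ∈ I, q i x) :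
    ∃ i ∈ I, ∃ᶠ x in l, q i x := by
  by_contra! hcon
  refine h ?_
  have : ∀ i ∈ I, ∀ᶠ x in l, ¬ q i x := fun i hi => by
    simpa [Filter.not_frequently] using hcon i hi
  filter_upwards [(eventually_all_finite hI).2 this] with x hx
  rintro ⟨i, hi, hq⟩
  exact hx i hi hq

/-- If the events `A k` are independent of `ℱ k` and have probability at least `c > 0`, then almost
surely, if the events `H k ∈ ℱ k` occur infinitely often, so do the events `H k ∩ A k`. -/
theorem ae_frequently_inter_of_indep {Ω : Type*} {m0 : MeasurableSpace Ω} {P : Measure Ω}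
    [IsProbabilityMeasure P] (ℱ : Filtration ℕ m0) (𝒢 : ℕ → MeasurableSpace Ω)
    (h𝒢 : ∀ k, 𝒢 k ≤ ℱ (k + 1)) (hind : ∀ k, Indep (𝒢 k) (ℱ k) P)
    {H A : ℕ → Set Ω} (hH : ∀ k, MeasurableSet[ℱ k] (H k)) (hA : ∀ k, MeasurableSet[𝒢 k] (A k))
    {c : ℝ} (hc : 0 < c) (hcA : ∀ k, c ≤ P.real (A k)) :
    ∀ᵐ ω ∂P, (∃ᶠ k in atTop, ω ∈ H k) → ∃ᶠ k in atTop, ω ∈ H k ∧ ω ∈ A k := by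
  -- The shift makes s (k + 1) = H k ∩ A k measurable at time k + 1, as Lévy's form of
  -- Borel–Cantelli requires; the empty set at index 0 is a filler.
  set s : ℕ → Set Ω := fun k => Nat.casesOn k ∅ fun k => H k ∩ A k with hs_def
  have hs : ∀ k, MeasurableSet[ℱ k] (s k) := by
    rintro (_ | k)
    · exact @MeasurableSet.empty _ (ℱ 0)
    · exact (ℱ.mono k.le_succ _ (hH k)).inter (h𝒢 k _ (hA k))
  have hcond : ∀ k, P[(s (k + 1)).indicator (1 : Ω → ℝ) | ℱ k] =ᵐ[P]
      (H k).indicator fun _ => P.real (A k) := by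
    intro k
    have hA0 : MeasurableSet (A k) := ℱ.le _ _ (h𝒢 k _ (hA k))
    have hint : Integrable ((A k).indicator (1 : Ω → ℝ)) P :=
      (integrable_const (1 : ℝ)).indicator hA0
    have h1 := condExp_indicator (m := ℱ k) hint (hH k)
    have h2 : P[(A k).indicator (1 : Ω → ℝ) | ℱ k] =ᵐ[P] fun _ => ∫ x, (A k).indicator 1 x ∂P :=
      condExp_indep_eq ((h𝒢 k).trans (ℱ.le _)) (ℱ.le k)
        ((stronglyMeasurable_const (b := (1 : ℝ))).indicator (hA k)) (hind k)
    rw [integral_indicator_one hA0] at h2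
    have h3 : (s (k + 1)).indicator (1 : Ω → ℝ) = (H k).indicator ((A k).indicator 1) := by
      rw [Set.indicator_indicator]
    rw [h3]
    refine h1.trans ?_
    filter_upwards [h2] with ω hω
    by_cases hωH : ω ∈ H k <;> simp [hωH, hω]
  filter_upwards [ae_mem_limsup_atTop_iff P hs, ae_all_iff.2 hcond] with ω hω hωc hfreq
  have hlim : ω ∈ limsup s atTop := by
    rw [hω]
    simp only [hωc]
    have hmono : Monotone fun n => ∑ k ∈ Finset.range n,
        (H k).indicator (fun _ => P.real (A k)) ω := by
      refine monotone_nat_of_le_succ fun n => ?_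
      rw [Finset.sum_range_succ]
      exact le_add_of_nonneg_right (Set.indicator_nonneg (fun _ _ => measureReal_nonneg) _)
    refine tendsto_atTop_atTop_of_monotone hmono fun b => ?_
    -- Each occurrence of some H k adds at least c to the sum of conditional probabilities.
    have key : ∀ N : ℕ, ∃ n, N * c ≤ ∑ k ∈ Finset.range n,
        (H k).indicator (fun _ => P.real (A k)) ω := by
      intro N
      induction N with
      | zero => exact ⟨0, by simp⟩
      | succ N ih =>
        obtain ⟨n, hn⟩ := ih
        obtain ⟨k, hk, hkH⟩ := frequently_atTop.1 hfreq n
        refine ⟨k + 1, ?_⟩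
        rw [Finset.sum_range_succ, Set.indicator_of_mem hkH]
        have := hmono hk
        simp only at this
        push_cast
        linarith [hcA k]
    obtain ⟨N, hN⟩ := exists_nat_ge (b / c)
    obtain ⟨n, hn⟩ := key N
    exact ⟨n, ((div_le_iff₀ hc).1 hN).trans hn⟩
  rw [mem_limsup_iff_frequently_mem, frequently_atTop] at hlim
  rw [frequently_atTop]
  intro N
  obtain ⟨_ | k, hk, hks⟩ := hlim (N + 1)
  · exact hks.elim
  · exact ⟨k, by omega, hks⟩

/-- Measurable near-minimization of a monotone family of losses over a compact set: the estimator
converges to the unique parameter at which all losses vanish. -/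
theorem exists_measurable_tendsto_of_loss {X : Type*} [MetricSpace X] [MeasurableSpace X]
    {K : Set X} (hK : IsCompact K) (hne : K.Nonempty)
    {D : ℕ → Type*} [∀ t, MeasurableSpace (D t)] (L : (t : ℕ) → X → D t → ℝ)
    (hcont : ∀ t d, Continuous fun x => L t x d) (hmeas : ∀ t x, Measurable (L t x)) :
    ∃ est : (t : ℕ) → D t → X, (∀ t, Measurable (est t)) ∧
      ∀ θ ∈ K, ∀ d : (t : ℕ) → D t, (∀ x, Monotone fun t => L t x (d t)) →
        (∀ t, L t θ (d t) ≤ 0) → (∀ x ∈ K, x ≠ θ → ∃ t, 0 < L t x (d t)) →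
        Tendsto (fun t => est t (d t)) atTop (𝓝 θ) := by
  classical
  have : Nonempty K := hne.to_subtype
  have : CompactSpace K := isCompact_iff_compactSpace.1 hK
  let x : ℕ → X := fun k => (TopologicalSpace.denseSeq K k : X)
  let good : (t : ℕ) → ℕ → D t → Prop := fun t k d => L t (x k) d < 1 / ((t : ℝ) + 1)
  -- The second alternative is a default for data with no good index, so that the least index exists
  -- for all data.
  let q : (t : ℕ) → ℕ → D t → Prop := fun t k d => good t k d ∨ ∀ k', ¬ good t k' d
  have hq : ∀ t d, ∃ k, q t k d := by
    intro t d
    by_cases h : ∃ k, good t k d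
    · exact h.imp fun k hk => Or.inl hk
    · exact ⟨0, Or.inr (not_exists.1 h)⟩
  have hgood : ∀ t k, MeasurableSet {d | good t k d} := fun t k =>
    measurableSet_lt (hmeas t (x k)) measurable_const
  have hqm : ∀ t k, MeasurableSet {d | q t k d} := fun t k =>
    (hgood t k).union (s₂ := {d | ∀ k', ¬ good t k' d}) <| by
      rw [Set.ofPred_forall]
      exact MeasurableSet.iInter fun k' => (hgood t k').compl
  refine ⟨fun t d => x (Nat.find (hq t d)), fun t =>
    Measurable.find (f := fun k _ => x k) (fun k => measurable_const) (hqm t) (hq t), ?_⟩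
  intro θ hθ d hmono hzero hpos
  have hest : ∀ t, L t (x (Nat.find (hq t (d t)))) (d t) < 1 / ((t : ℝ) + 1) := by
    intro t
    rcases Nat.find_spec (hq t (d t)) with h | h
    · exact h
    · exfalso
      -- The default never occurs here: the sublevel set is open and contains θ, so it meets the
      -- dense sequence.
      have hopen : IsOpen {z : K | L t z (d t) < 1 / ((t : ℝ) + 1)} :=
        isOpen_lt ((hcont t (d t)).comp continuous_subtype_val) continuous_const
      obtain ⟨k, hk⟩ := (TopologicalSpace.denseRange_denseSeq K).exists_mem_open hopen
        ⟨⟨θ, hθ⟩, (hzero t).trans_lt (by positivity)⟩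
      exact h k hk
  -- By compactness it suffices to exclude cluster points z ≠ θ. Near z the loss at time T exceeds ε
  -- / 2, hence by monotonicity so do all later losses, whereas the loss of the estimate at time t
  -- is below 1 / (t + 1).
  refine hK.tendsto_nhds_of_unique_mapClusterPt
    (Eventually.of_forall fun t => (TopologicalSpace.denseSeq K _).2) fun z hz hcl => ?_
  by_contra hzθ
  obtain ⟨T, hT⟩ := hpos z hz hzθ
  set ε := L T z (d T) with hε
  have hnear : ∀ᶠ z' in 𝓝 z, ε / 2 < L T z' (d T) :=
    (hcont T (d T)).continuousAt.eventually (lt_mem_nhds (by simp only [← hε]; linarith))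
  have hsmall : ∀ᶠ t : ℕ in atTop, 1 / ((t : ℝ) + 1) < ε / 2 :=
    tendsto_one_div_add_atTop_nhds_zero_nat.eventually (gt_mem_nhds (by linarith))
  obtain ⟨t, h1, h2, h3⟩ := ((hcl.frequently hnear).and_eventually
    (hsmall.and (eventually_ge_atTop T))).exists
  have h4 := hmono (x (Nat.find (hq t (d t)))) h3
  have h5 := hest t
  simp only at h1 h4
  linarith

end General

/-! ### Compactness along trajectories -/

section Deterministic

variable {Ω : Type*} {n r p m : ℕ} {f : Vec n → Regressor p m → Vec p}
  {f' : Vec r → Regressor p m → Vec p} {θ : Vec n} {e : Experiment Ω r p m} {w : ℕ → Ω → Vec p}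

theorem continuous_push :
    Continuous fun z : Vec p × Regressor p m => push z.1 z.2 := by
  refine (PiLp.continuous_toLp 2 _).comp (continuous_pi fun j => ?_)
  split_ifs <;> fun_prop

theorem phi_succ (t : ℕ) (ω : Ω) : phi f f' θ e w (t + 1) ω =
    push (drift f f' θ e w t ω + w (t + 1) ω) (phi f f' θ e w t ω) := rfl

/-- The coordinates of the regressor are the past outputs. -/
theorem phi_apply (ω : Ω) {t : ℕ} (j : Fin m) (hj : (j : ℕ) < t) :
    phi f f' θ e w t ω j =
      drift f f' θ e w (t - 1 - j) ω + w (t - 1 - j + 1) ω := by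
  induction t generalizing j with
  | zero => omega
  | succ t ih =>
    rw [phi_succ]
    rcases Nat.eq_zero_or_pos (j : ℕ) with h | h
    · simp [push, h]
    · have hj' : (j : ℕ) - 1 < t := by omega
      have := ih ⟨(j : ℕ) - 1, lt_of_le_of_lt (Nat.sub_le _ _) j.isLt⟩ hj'
      have h2 : t - 1 - ((j : ℕ) - 1) = t + 1 - 1 - j := by omega
      simp only [h2] at this
      simp only [push, h.ne', if_false]
      exact this

theorem isCompact_hyperrectangle (a b : Fin n → ℝ) : IsCompact (hyperrectangle a b) := by
  have h : hyperrectangle a b = WithLp.ofLp ⁻¹' Set.Icc a b := by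
    ext x
    simp [hyperrectangle, Set.mem_Icc, Pi.le_def, forall_and]
  rw [h]
  exact (PiLp.homeomorph 2 fun _ : Fin n => ℝ).isCompact_preimage.2 isCompact_Icc

/-- Along a trajectory with parameters in a compact set, bounded inputs and bounded noise, the
regressor `k` steps after a visit to a fixed ball stays in a compact set. -/
theorem exists_isCompact_phi_add_mem {Θ : Set (Vec n)} (hΘ : IsCompact Θ)
    (hf : Continuous (Function.uncurry f)) (hf' : Continuous (Function.uncurry f'))
    (Cu Cw C : ℝ) (k : ℕ) :
    ∃ K : Set (Regressor p m), IsCompact K ∧ ∀ {Ω : Type*} (θ) (_ : θ ∈ Θ)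
      (e : Experiment Ω r p m) (w : ℕ → Ω → Vec p) (ω : Ω),
      (∀ t, 1 ≤ t → ‖e.input t ω‖ ≤ Cu) → (∀ t, 1 ≤ t → ‖w t ω‖ ≤ Cw) →
      ∀ t, 1 ≤ t → ‖phi f f' θ e w t ω‖ ≤ C → phi f f' θ e w (t + k) ω ∈ K := by
  induction k with
  | zero =>
    refine ⟨Metric.closedBall 0 C, isCompact_closedBall _ _, ?_⟩
    intro Ω θ _ e w ω _ _ t _ h
    simpa using h
  | succ k ih =>
    obtain ⟨K, hK, hKφ⟩ := ih
    -- One step of the dynamics as a continuous map of parameter, input, noise and regressor; the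
    -- next compact set is its image, uniformly in θ.
    let g : Vec n × Vec r × Vec p × Regressor p m → Regressor p m := fun z =>
      push (f z.1 z.2.2.2 + f' z.2.1 z.2.2.2 + z.2.2.1) z.2.2.2
    have hg : Continuous g := by
      have h1 : Continuous fun z : Vec n × Vec r × Vec p × Regressor p m => f z.1 z.2.2.2 :=
        hf.comp (f := fun z : Vec n × Vec r × Vec p × Regressor p m => (z.1, z.2.2.2))
          (by fun_prop)
      have h2 : Continuous fun z : Vec n × Vec r × Vec p × Regressor p m => f' z.2.1 z.2.2.2 :=
        hf'.comp (f := fun z : Vec n × Vec r × Vec p × Regressor p m => (z.2.1, z.2.2.2))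
          (by fun_prop)
      exact continuous_push.comp
        (((h1.add h2).add (by fun_prop)).prodMk (by fun_prop :
          Continuous fun z : Vec n × Vec r × Vec p × Regressor p m => z.2.2.2))
    refine ⟨g '' (Θ ×ˢ Metric.closedBall 0 Cu ×ˢ Metric.closedBall 0 Cw ×ˢ K),
      (hΘ.prod ((isCompact_closedBall _ _).prod ((isCompact_closedBall _ _).prod hK))).image hg,
      ?_⟩
    intro Ω θ hθ e w ω hu hw t ht hφ
    refine ⟨(θ, e.input (t + k) ω, w (t + k + 1) ω, phi f f' θ e w (t + k) ω),
      ⟨hθ, ?_, ?_, hKφ θ hθ e w ω hu hw t ht hφ⟩, rfl⟩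
    · simpa using hu (t + k) (by omega)
    · simpa using hw (t + k + 1) (by omega)

/-- A bound for the noise-free part of the outputs in the `m` steps after a visit to a ball. -/
theorem exists_norm_drift_le {Θ : Set (Vec n)} (hΘ : IsCompact Θ)
    (hf : Continuous (Function.uncurry f)) (hf' : Continuous (Function.uncurry f'))
    (Cu Cw C : ℝ) (N : ℕ) :
    ∃ C₀ : ℝ, 0 < C₀ ∧ ∀ {Ω : Type*} (θ) (_ : θ ∈ Θ)
      (e : Experiment Ω r p m) (w : ℕ → Ω → Vec p) (ω : Ω),
      (∀ t, 1 ≤ t → ‖e.input t ω‖ ≤ Cu) → (∀ t, 1 ≤ t → ‖w t ω‖ ≤ Cw) →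
      ∀ t, 1 ≤ t → ‖phi f f' θ e w t ω‖ ≤ C →
        ∀ i, t ≤ i → i < t + N → ‖drift f f' θ e w i ω‖ ≤ C₀ := by
  choose K hK hKφ using exists_isCompact_phi_add_mem hΘ hf hf' Cu Cw C
  have hKN : IsCompact (⋃ k ∈ Finset.range N, K k) :=
    (Finset.range N).isCompact_biUnion fun k _ => hK k
  have hcont : Continuous fun z : Vec n × Vec r × Regressor p m => f z.1 z.2.2 + f' z.2.1 z.2.2 :=
    (hf.comp (f := fun z : Vec n × Vec r × Regressor p m => (z.1, z.2.2)) (by fun_prop)).add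
      (hf'.comp (f := fun z : Vec n × Vec r × Regressor p m => (z.2.1, z.2.2)) (by fun_prop))
  obtain ⟨M, hM⟩ := (hΘ.prod ((isCompact_closedBall (0 : Vec r) Cu).prod
    hKN)).exists_bound_of_continuousOn hcont.continuousOn
  refine ⟨max M 1, lt_max_of_lt_right one_pos, ?_⟩
  intro Ω θ hθ e w ω hu hw t ht hφ i hti hiN
  obtain ⟨k, rfl⟩ := Nat.exists_eq_add_of_le hti
  refine (hM (θ, e.input (t + k) ω, phi f f' θ e w (t + k) ω) ⟨hθ, ?_, ?_⟩).trans (le_max_left _ _)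
  · simpa using hu (t + k) (by omega)
  · exact Set.mem_biUnion (Finset.mem_coe.2 (Finset.mem_range.2 (by omega)))
      (hKφ k θ hθ e w ω hu hw t ht hφ)

end Deterministic

/-! ### Prediction errors and the loss of a parameter -/

section Loss

variable {Ω : Type*} {n r p m : ℕ} {f : Vec n → Regressor p m → Vec p}
  {f' : Vec r → Regressor p m → Vec p} {θ : Vec n} {e : Experiment Ω r p m} {w : ℕ → Ω → Vec p}

/-- The regressor `(y_s, …, y_{s-m+1})` read off a data sequence, for `s ≥ m`. -/
noncomputable def dataRegressor (d : ℕ → Vec p × Vec r) (s : ℕ) : Regressor p m :=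
  WithLp.toLp 2 fun j : Fin m => (d (s - 1 - j)).1

/-- The one-step prediction error `y_{s+1} - f(x, φ_s) - f'(u_s, φ_s)` for the parameter `x`. -/
noncomputable def predictionError (f : Vec n → Regressor p m → Vec p)
    (f' : Vec r → Regressor p m → Vec p) (x : Vec n) (d : ℕ → Vec p × Vec r) (s : ℕ) : Vec p :=
  (d s).1 - f x (dataRegressor d s) - f' (d s).2 (dataRegressor d s)

/-- The total amount by which the prediction errors for `x` exceed the noise bound. -/
noncomputable def loss (f : Vec n → Regressor p m → Vec p)
    (f' : Vec r → Regressor p m → Vec p) (Cw : ℝ) (x : Vec n) (d : ℕ → Vec p × Vec r)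
    (t : ℕ) : ℝ :=
  ∑ s ∈ (Finset.range t).filter (m ≤ ·), max 0 (‖predictionError f f' x d s‖ - Cw)

/-- Finitely many data, continued by zero. -/
noncomputable def extendData {t : ℕ} (d : Fin t → Vec p × Vec r) : ℕ → Vec p × Vec r :=
  fun s => if h : s < t then d ⟨s, h⟩ else 0

theorem continuous_extendData {t : ℕ} :
    Continuous (extendData : (Fin t → Vec p × Vec r) → ℕ → Vec p × Vec r) := by
  refine continuous_pi fun s => ?_
  unfold extendData
  split_ifs <;> fun_prop

theorem continuous_loss (hf : Continuous (Function.uncurry f))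
    (hf' : Continuous (Function.uncurry f')) (Cw : ℝ) (t : ℕ) :
    Continuous fun z : Vec n × (ℕ → Vec p × Vec r) => loss f f' Cw z.1 z.2 t := by
  have hreg : ∀ s, Continuous fun z : Vec n × (ℕ → Vec p × Vec r) =>
      (dataRegressor z.2 s : Regressor p m) := fun s =>
    (PiLp.continuous_toLp 2 _).comp (continuous_pi fun j => by fun_prop)
  refine continuous_finsetSum _ fun s _ => continuous_const.max (Continuous.sub ?_ (by fun_prop))
  refine Continuous.norm (Continuous.sub (Continuous.sub (by fun_prop) ?_) ?_)
  · exact hf.comp (continuous_fst.prodMk (hreg s))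
  · exact hf'.comp (Continuous.prodMk (by fun_prop) (hreg s))

theorem measurable_loss_extendData (hf : Continuous (Function.uncurry f))
    (hf' : Continuous (Function.uncurry f')) (Cw : ℝ) (t : ℕ) (x : Vec n) :
    Measurable fun d : Fin t → Vec p × Vec r => loss f f' Cw x (extendData d) t := by
  have h : Continuous fun d : Fin t → Vec p × Vec r => loss f f' Cw x (extendData d) t :=
    (continuous_loss hf hf' Cw t).comp (f := fun d : Fin t → Vec p × Vec r => (x, extendData d))
      (continuous_const.prodMk continuous_extendData)
  exact h.measurable

/-- The terms up to time t use only data of index below t, so continuing finite data by zero does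
not affect the loss. -/
theorem loss_congr {d d' : ℕ → Vec p × Vec r} {t : ℕ} (h : ∀ s < t, d s = d' s) (Cw : ℝ)
    (x : Vec n) : loss f f' Cw x d t = loss f f' Cw x d' t := by
  refine Finset.sum_congr rfl fun s hs => ?_
  simp only [Finset.mem_filter, Finset.mem_range] at hs
  have hreg : (dataRegressor d s : Regressor p m) = dataRegressor d' s := by
    unfold dataRegressor
    congr 1
    funext j
    rw [h _ (by omega)]
  simp only [predictionError, hreg, h s hs.1]

theorem monotone_loss (Cw : ℝ) (x : Vec n) (d : ℕ → Vec p × Vec r) :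
    Monotone (loss f f' Cw x d) := fun _ _ hst =>
  Finset.sum_le_sum_of_subset_of_nonneg
    (Finset.filter_subset_filter _ (Finset.range_mono hst)) fun _ _ _ => le_max_left _ _

/-- From time m on the regressor consists of observed outputs alone; earlier it still involves φ_0,
which the estimator does not see. This is why the loss omits the terms with s < m. -/
theorem predictionError_data (x : Vec n) (ω : Ω) {s : ℕ} (hs : m ≤ s) :
    predictionError f f' x (fun s => (drift f f' θ e w s ω + w (s + 1) ω, e.input s ω)) s =
      w (s + 1) ω + (f θ (phi f f' θ e w s ω) - f x (phi f f' θ e w s ω)) := by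
  have hreg : dataRegressor (fun s => (drift f f' θ e w s ω + w (s + 1) ω, e.input s ω)) s =
      phi f f' θ e w s ω := by
    ext1 j
    rw [phi_apply ω j (j.2.trans_le hs)]
    rfl
  rw [predictionError, hreg]
  simp only [drift]
  abel

/-- If almost surely every wrong parameter produces a prediction error exceeding the noise bound,
then the system is identifiable. -/
theorem identifiable_of_ae_exists_lt [MeasurableSpace Ω] {P : Measure Ω} {Θ : Set (Vec n)}
    (hΘ : IsCompact Θ) (hne : Θ.Nonempty) (hf : Continuous (Function.uncurry f))
    (hf' : Continuous (Function.uncurry f')) {e : Vec n → Experiment Ω r p m} {Cw : ℝ}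
    (hw : ∀ᵐ ω ∂P, ∀ t, 1 ≤ t → ‖w t ω‖ ≤ Cw)
    (h : ∀ θ ∈ Θ, ∀ᵐ ω ∂P, ∀ x ∈ Θ, x ≠ θ → ∃ s, m ≤ s ∧
      Cw < ‖w (s + 1) ω +
        (f θ (phi f f' θ (e θ) w s ω) - f x (phi f f' θ (e θ) w s ω))‖) :
    Identifiable P Θ f f' e w := by
  obtain ⟨est, hmeas, hest⟩ := exists_measurable_tendsto_of_loss hΘ hne
    (D := fun t => Fin t → Vec p × Vec r) (fun t x d => loss f f' Cw x (extendData d) t)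
    (fun t d => (continuous_loss hf hf' Cw t).comp (f := fun x => (x, extendData d))
      (continuous_id.prodMk continuous_const))
    (fun t x => measurable_loss_extendData hf hf' Cw t x)
  refine ⟨est, hmeas, fun θ hθ => ?_⟩
  filter_upwards [hw, h θ hθ] with ω hwω hω
  set d : ℕ → Vec p × Vec r :=
    fun s => (drift f f' θ (e θ) w s ω + w (s + 1) ω, e θ |>.input s ω) with hd
  have hL : ∀ t x, loss f f' Cw x (extendData (data f f' θ (e θ) w t ω)) t =
      loss f f' Cw x d t := fun t x => loss_congr (fun s hs => by simp [extendData, hs, data, hd]) _ _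
  refine hest θ hθ (fun t => data f f' θ (e θ) w t ω) ?_ ?_ ?_
  · intro x
    simp only [hL]
    exact monotone_loss Cw x d
  · intro t
    rw [hL]
    refine Finset.sum_nonpos fun s hs => ?_
    simp only [Finset.mem_filter, Finset.mem_range] at hs
    rw [hd, predictionError_data θ ω hs.2]
    simpa using hwω (s + 1) (by omega)
  -- A single error above C_w makes one summand positive, and no summand is negative.
  · intro x hx hxθ
    obtain ⟨s, hs, hlt⟩ := hω x hx hxθ
    refine ⟨s + 1, ?_⟩
    rw [hL]
    refine Finset.sum_pos' (fun _ _ => le_max_left _ _) ⟨s, by simp [hs], ?_⟩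
    rw [hd, predictionError_data x ω hs]
    exact lt_max_of_lt_right (sub_pos.2 hlt)

end Loss

/-! ### Measurability with respect to the past -/

section Measurability

variable {Ω : Type*} {n r p m : ℕ} {f : Vec n → Regressor p m → Vec p}
  {f' : Vec r → Regressor p m → Vec p} {θ : Vec n} {e : Experiment Ω r p m} {w : ℕ → Ω → Vec p}

theorem past_mono (e : Experiment Ω r p m) (w : ℕ → Ω → Vec p) : Monotone (past e w) := by
  intro s t hst
  refine sup_le_sup (sup_le_sup le_rfl ?_) ?_
  · exact iSup_mono fun i => iSup_mono' fun h => ⟨h.trans_le hst, le_rfl⟩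
  · exact iSup_mono fun i => iSup_mono' fun h => ⟨⟨h.1, h.2.trans_le hst⟩, le_rfl⟩

theorem comap_init_le_past (t : ℕ) :
    MeasurableSpace.comap e.init inferInstance ≤ past e w t :=
  le_sup_left.trans le_sup_left

theorem comap_input_le_past {i t : ℕ} (h : i < t) :
    MeasurableSpace.comap (e.input i) inferInstance ≤ past e w t :=
  (le_iSup₂_of_le (f := fun i (_ : i < t) => MeasurableSpace.comap (e.input i) inferInstance)
    i h le_rfl).trans (le_sup_right.trans le_sup_left)

theorem comap_noise_le_past {i t : ℕ} (h1 : 1 ≤ i) (h : i < t) :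
    MeasurableSpace.comap (w i) inferInstance ≤ past e w t :=
  (le_iSup₂_of_le (f := fun i (_ : 1 ≤ i ∧ i < t) => MeasurableSpace.comap (w i) inferInstance)
    i ⟨h1, h⟩ le_rfl).trans le_sup_right

theorem past_le [m0 : MeasurableSpace Ω] (hinit : Measurable e.init)
    (hinput : ∀ t, Measurable (e.input t)) (hw : ∀ t, 1 ≤ t → Measurable (w t)) (t : ℕ) :
    past e w t ≤ m0 :=
  sup_le (sup_le hinit.comap_le (iSup₂_le fun i _ => (hinput i).comap_le))
    (iSup₂_le fun i hi => (hw i hi.1).comap_le)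

theorem measurable_drift_of_measurable_phi {m' : MeasurableSpace Ω}
    (hf : Continuous (Function.uncurry f)) (hf' : Continuous (Function.uncurry f')) {t : ℕ}
    (hφ : Measurable (phi f f' θ e w t)) (hu : Measurable (e.input t)) :
    Measurable (drift f f' θ e w t) :=
  (hf.measurable.comp (measurable_const.prodMk hφ)).add (hf'.measurable.comp (hu.prodMk hφ))

theorem measurable_phi_past (hf : Continuous (Function.uncurry f))
    (hf' : Continuous (Function.uncurry f')) {s t : ℕ} (hst : s < t) :
    Measurable[past e w t] (phi f f' θ e w s) := by
  induction s with
  | zero => exact measurable_iff_comap_le.2 (comap_init_le_past t)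
  | succ s ih =>
    have hφ := ih (by omega)
    have hu : Measurable[past e w t] (e.input s) :=
      measurable_iff_comap_le.2 (comap_input_le_past (by omega))
    have hw : Measurable[past e w t] (w (s + 1)) :=
      measurable_iff_comap_le.2 (comap_noise_le_past (by omega) hst)
    exact continuous_push.measurable.comp
      (((measurable_drift_of_measurable_phi hf hf' hφ hu).add hw).prodMk hφ)

/-- For t = s + 1: the drift is fixed before w_{s+1} acts, so the noise needed to hit a target is
determined by the past. -/
theorem measurable_drift_past (hf : Continuous (Function.uncurry f))
    (hf' : Continuous (Function.uncurry f')) {s t : ℕ} (hst : s < t) :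
    Measurable[past e w t] (drift f f' θ e w s) :=
  measurable_drift_of_measurable_phi hf hf' (measurable_phi_past hf hf' hst)
    (measurable_iff_comap_le.2 (comap_input_le_past hst))

theorem measurable_output_past (hf : Continuous (Function.uncurry f))
    (hf' : Continuous (Function.uncurry f')) {s t : ℕ} (hst : s + 1 < t) :
    Measurable[past e w t] fun ω => drift f f' θ e w s ω + w (s + 1) ω :=
  (measurable_drift_past hf hf' (by omega)).add
    (measurable_iff_comap_le.2 (comap_noise_le_past (by omega) hst))

end Measurability

/-! ### Steering the outputs by the noise -/

section Probability

variable {Ω : Type*} [m0 : MeasurableSpace Ω] {P : Measure Ω} {n r p m : ℕ}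
  {f : Vec n → Regressor p m → Vec p} {f' : Vec r → Regressor p m → Vec p} {θ : Vec n}
  {e : Experiment Ω r p m} {w : ℕ → Ω → Vec p} {Cw Cu C C₀ : ℝ}

theorem Noise.ae_norm_le (hw : Noise P Cw w) : ∀ᵐ ω ∂P, ∀ t, 1 ≤ t → ‖w t ω‖ ≤ Cw := by
  refine ae_all_iff.2 fun t => ?_
  by_cases ht : 1 ≤ t
  · filter_upwards [(hw.identDistrib t ht).symm.ae_snd (p := fun z => ‖z‖ ≤ Cw)
      (measurableSet_le measurable_norm measurable_const) hw.bounded] with ω hω _ using hω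
  · exact Eventually.of_forall fun ω h => absurd h ht

/-- From infinitely many past events, almost surely infinitely many are followed by a noise value
in a given ball centred in the closed ball of radius `C_w`. -/
theorem Noise.ae_frequently_mem_ball [IsProbabilityMeasure P] (hw : Noise P Cw w)
    (he : Admissible P Cu e) (hind : IndepOfPast P e w) (k : ℕ) {H : ℕ → Set Ω}
    (hH : ∀ t, MeasurableSet[past e w (t + k + 1)] (H t)) {q : Vec p}
    (hq : q ∈ Metric.closedBall (0 : Vec p) Cw) {δ : ℝ} (hδ : 0 < δ) :
    ∀ᵐ ω ∂P, (∃ᶠ t in atTop, ω ∈ H t) →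
      ∃ᶠ t in atTop, ω ∈ H t ∧ w (t + k + 1) ω ∈ Metric.ball q δ := by
  let ℱ : Filtration ℕ m0 :=
    { seq := fun t => past e w (t + k + 1)
      mono' := fun s t hst => past_mono e w (by omega)
      le' := fun t => past_le he.measurable_init he.measurable_input hw.measurable _ }
  have hpos : 0 < P (w 1 ⁻¹' Metric.ball q δ) := (hw.charges δ hδ).trans_le (iInf₂_le q hq)
  refine ae_frequently_inter_of_indep ℱ (A := fun t => w (t + k + 1) ⁻¹' Metric.ball q δ)
    (fun t => MeasurableSpace.comap (w (t + k + 1)) inferInstance)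
    (fun t => comap_noise_le_past (by omega) (by omega)) (fun t => hind _ (by omega)) hH
    (fun t => ⟨_, measurableSet_ball, rfl⟩)
    (c := P.real (w 1 ⁻¹' Metric.ball q δ)) (ENNReal.toReal_pos hpos.ne' (measure_ne_top _ _))
    fun t => le_of_eq ?_
  rw [measureReal_def, measureReal_def,
    (hw.identDistrib (t + k + 1) (by omega)).measure_mem_eq measurableSet_ball]

/-- If every point of the closed ball of radius `C₀` is at distance less than `C_w` from each finite
set `F i`, then almost surely, infinitely often, `‖φ_t‖ ≤ C` and the next `k` outputs are close to
`F 0, …, F (k - 1)`. -/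
theorem ae_frequently_outputs_near [IsProbabilityMeasure P] (hw : Noise P Cw w)
    (he : Admissible P Cu e) (hind : IndepOfPast P e w) (hf : Continuous (Function.uncurry f))
    (hf' : Continuous (Function.uncurry f')) (hrec : Recurrent P f f' θ e w C)
    (hC₀ : DriftBound P f f' θ e w C C₀) {F : ℕ → Set (Vec p)} (hF : ∀ i, (F i).Finite)
    (hFC : ∀ i, ∀ z ∈ Metric.closedBall (0 : Vec p) C₀, ∃ η ∈ F i, dist z η < Cw)
    {δ : ℝ} (hδ : 0 < δ) {k : ℕ} (hk : k ≤ m) :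
    ∀ᵐ ω ∂P, ∃ᶠ t in atTop, ‖phi f f' θ e w t ω‖ ≤ C ∧
      ∀ i < k, ∃ η ∈ F i, dist (drift f f' θ e w (t + i) ω + w (t + i + 1) ω) η < δ := by
  induction k with
  | zero => simpa [Recurrent] using hrec
  | succ k ih =>
    -- The noise needed to reach η is η minus the drift, which is random. A finite net of the noise
    -- ball reduces it to finitely many deterministic targets.
    obtain ⟨Q, hQ, hQfin, hQcover⟩ := (isCompact_closedBall (0 : Vec p) Cw).elim_finite_subcover_image
      (b := Metric.closedBall (0 : Vec p) Cw) (c := fun q => Metric.ball q (δ / 2))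
      (fun _ _ => Metric.isOpen_ball)
      fun q hq => Set.mem_biUnion hq (Metric.mem_ball_self (half_pos hδ))
    let H : Vec p × Vec p → ℕ → Set Ω := fun z t =>
      {ω | (‖phi f f' θ e w t ω‖ ≤ C ∧
        ∀ i < k, ∃ η ∈ F i, dist (drift f f' θ e w (t + i) ω + w (t + i + 1) ω) η < δ) ∧
        dist (z.1 - drift f f' θ e w (t + k) ω) z.2 < δ / 2}
    have hH : ∀ z t, MeasurableSet[past e w (t + k + 1)] (H z t) := by
      intro z t
      have h1 : MeasurableSet[past e w (t + k + 1)] {ω | ‖phi f f' θ e w t ω‖ ≤ C} :=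
        measurable_phi_past hf hf' (by omega) (measurableSet_le measurable_norm measurable_const)
      have h2 : MeasurableSet[past e w (t + k + 1)] {ω | ∀ i < k, ∃ η ∈ F i,
          dist (drift f f' θ e w (t + i) ω + w (t + i + 1) ω) η < δ} := by
        have : {ω | ∀ i < k, ∃ η ∈ F i,
            dist (drift f f' θ e w (t + i) ω + w (t + i + 1) ω) η < δ} =
            ⋂ i, ⋂ (_ : i < k), (fun ω => drift f f' θ e w (t + i) ω + w (t + i + 1) ω) ⁻¹'
              {y | ∃ η ∈ F i, dist y η < δ} := by
          ext ω
          simp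
        rw [this]
        refine MeasurableSet.iInter fun i => MeasurableSet.iInter fun hi =>
          measurable_output_past hf hf' (by omega) (IsOpen.measurableSet ?_)
        have hU : {y | ∃ η ∈ F i, dist y η < δ} = ⋃ η ∈ F i, Metric.ball η δ := by
          ext y
          simp
        rw [hU]
        exact isOpen_biUnion fun _ _ => Metric.isOpen_ball
      have h3 : MeasurableSet[past e w (t + k + 1)]
          {ω | dist (z.1 - drift f f' θ e w (t + k) ω) z.2 < δ / 2} :=
        measurable_drift_past (t := t + k + 1) hf hf' (by omega)
          (IsOpen.measurableSet (s := {y | dist (z.1 - y) z.2 < δ / 2})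
            (isOpen_lt (by fun_prop) continuous_const))
      exact (h1.inter h2).inter h3
    have hstep : ∀ᵐ ω ∂P, ∀ z ∈ F k ×ˢ Q, (∃ᶠ t in atTop, ω ∈ H z t) →
        ∃ᶠ t in atTop, ω ∈ H z t ∧ w (t + k + 1) ω ∈ Metric.ball z.2 (δ / 2) :=
      (ae_ball_iff ((hF k).prod hQfin).countable).2 fun z hz =>
        hw.ae_frequently_mem_ball he hind k (hH z) (hQ hz.2) (half_pos hδ)
    filter_upwards [ih (by omega), hstep, hC₀] with ω hω hωstep hωC₀
    -- The drift bound and `hFC` put η minus the drift inside the noise ball, hence near some q in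
    -- the net. One of the finitely many pairs (η, q) then recurs infinitely often.
    have hex : ∃ᶠ t in atTop, ∃ z ∈ F k ×ˢ Q, ω ∈ H z t := by
      refine (hω.and_eventually (eventually_ge_atTop 1)).mono fun t ⟨ht, ht1⟩ => ?_
      obtain ⟨η, hη, hηd⟩ := hFC k (drift f f' θ e w (t + k) ω)
        (by simpa using hωC₀ t ht1 ht.1 (t + k) (by omega) (by omega))
      obtain ⟨q, hqQ, hq⟩ := Set.mem_iUnion₂.1 (hQcover (a := η - drift f f' θ e w (t + k) ω)
        (by rw [mem_closedBall_zero_iff, ← dist_eq_norm, dist_comm]; exact hηd.le))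
      exact ⟨(η, q), ⟨hη, hqQ⟩, ht, hq⟩
    obtain ⟨z, hz, hzf⟩ :=
      exists_mem_frequently_of_frequently_exists_mem ((hF k).prod hQfin) hex
    refine (hωstep z hz hzf).mono fun t ⟨⟨⟨h1, h2⟩, h3⟩, h4⟩ => ⟨h1, fun i hi => ?_⟩
    rcases Nat.lt_succ_iff_lt_or_eq.1 hi with hi | rfl
    · exact h2 i hi
    · refine ⟨z.1, hz.1, ?_⟩
      rw [Metric.mem_ball] at h4
      calc dist (drift f f' θ e w (t + i) ω + w (t + i + 1) ω) z.1
          = dist (w (t + i + 1) ω) (z.1 - drift f f' θ e w (t + i) ω) := by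
            rw [dist_eq_norm, dist_eq_norm]; congr 1; abel
        _ ≤ dist (w (t + i + 1) ω) z.2 + dist (z.1 - drift f f' θ e w (t + i) ω) z.2 :=
            dist_triangle_right _ _ _
        _ < δ := by linarith

/-- A density bound gives, for each coordinate, a finite set that is within `C_w` of every point of
the closed ball of radius `C₀`. -/
theorem exists_finite_of_lt_lowerDensity {l : ℕ} {E : Set (Vec l)} (hCw : 0 < Cw)
    (h : ENNReal.ofReal (1 / Cw) < lowerDensity E (Metric.closedBall 0 C₀)) :
    ∃ F ⊆ E, F.Finite ∧
      ∀ z ∈ Metric.closedBall (0 : Vec l) C₀, ∃ η ∈ F, dist z η < Cw := by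
  -- Inverting, the supremum of the distances to E is below C_w, so the C_w-balls centred in E cover
  -- the compact ball.
  rw [lowerDensity, one_div, ENNReal.ofReal_inv_of_pos hCw, ENNReal.inv_lt_inv] at h
  have hE : ∀ z ∈ Metric.closedBall (0 : Vec l) C₀, ∃ η ∈ E, dist z η < Cw := by
    intro z hz
    have hz' := (le_iSup₂ (f := fun z (_ : z ∈ Metric.closedBall (0 : Vec l) C₀) =>
      ⨅ (d : ℝ) (_ : 0 < d ∧ (Metric.ball z d ∩ E).Nonempty), ENNReal.ofReal d) z hz).trans_lt h
    simp only [iInf_lt_iff] at hz'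
    obtain ⟨d, ⟨_, η, hηd, hηE⟩, hd⟩ := hz'
    rw [Metric.mem_ball'] at hηd
    exact ⟨η, hηE, hηd.trans ((ENNReal.ofReal_lt_ofReal_iff hCw).1 hd)⟩
  obtain ⟨F, hFE, hFfin, hF⟩ := (isCompact_closedBall (0 : Vec l) C₀).elim_finite_subcover_image
    (b := E) (c := fun η => Metric.ball η Cw) (fun _ _ => Metric.isOpen_ball) fun z hz => by
      simpa using hE z hz
  exact ⟨F, hFE, hFfin, fun z hz => by simpa using hF hz⟩

end Probability

/-! ### Refuting a neighbourhood of a wrong parameter -/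

section Elimination

/-- A continuous function is close to its values at finitely many points on uniform
neighbourhoods of these points. -/
theorem exists_pos_forall_dist_lt {X Y ι : Type*} [PseudoMetricSpace X] [PseudoMetricSpace Y]
    {g : X → Y} (hg : Continuous g) {G : Set ι} (hG : G.Finite) (c : ι → X) {ε : ι → ℝ}
    (hε : ∀ i ∈ G, 0 < ε i) :
    ∃ δ > 0, ∀ i ∈ G, ∀ z, dist z (c i) < δ → dist (g z) (g (c i)) < ε i := by
  have h : ∀ᶠ δ in 𝓝[>] (0 : ℝ), ∀ i ∈ G, ∀ z, dist z (c i) < δ → dist (g z) (g (c i)) < ε i := by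
    refine (eventually_all_finite hG).2 fun i hi => ?_
    obtain ⟨δ₀, hδ₀, h⟩ := Metric.continuous_iff.1 hg (c i) (ε i) (hε i hi)
    filter_upwards [Ioo_mem_nhdsGT hδ₀] with δ hδ z hz using h z (hz.trans hδ.2)
  obtain ⟨δ, h, hδ⟩ := (h.and self_mem_nhdsWithin).exists
  exact ⟨δ, hδ, h⟩

/-- A noise value close to the extreme point in the direction of `v₀` pushes every perturbation of
`v₀` out of the ball of radius `c`. -/
theorem lt_norm_add_of_near_extreme {V : Type*} [NormedAddCommGroup V] [NormedSpace ℝ V]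
    {c : ℝ} (hc : 0 ≤ c) {v₀ v y : V} (hv₀ : v₀ ≠ 0) (hv : dist v v₀ < ‖v₀‖ / 4)
    (hy : dist y ((c / ‖v₀‖) • v₀) < ‖v₀‖ / 2) : c < ‖y + v‖ := by
  have hpos : 0 < ‖v₀‖ := norm_pos_iff.2 hv₀
  -- The unperturbed sum exceeds c by ‖v₀‖, while the two perturbations cost less than 3/4 of ‖v₀‖.
  have h1 : ‖(c / ‖v₀‖) • v₀ + v₀‖ = c + ‖v₀‖ := by
    have : (c / ‖v₀‖) • v₀ + v₀ = (c / ‖v₀‖ + 1) • v₀ := by rw [add_smul, one_smul]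
    rw [this, norm_smul, Real.norm_of_nonneg (by positivity)]
    field_simp
  have h2 : ‖(c / ‖v₀‖) • v₀ + v₀‖ ≤ ‖y + v‖ + dist ((c / ‖v₀‖) • v₀ + v₀) (y + v) := by
    rw [dist_eq_norm]
    exact norm_le_norm_add_norm_sub' _ _
  have h3 := dist_add_add_le ((c / ‖v₀‖) • v₀) v₀ y v
  rw [dist_comm _ y, dist_comm _ v] at h3
  linarith

variable {Ω : Type*} [m0 : MeasurableSpace Ω] {P : Measure Ω} {n r p m : ℕ}
  {f : Vec n → Regressor p m → Vec p} {f' : Vec r → Regressor p m → Vec p} {θ : Vec n}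
  {e : Experiment Ω r p m} {w : ℕ → Ω → Vec p} {Cw Cu C C₀ : ℝ}

/-- A parameter that the density condition separates from the true one has a neighbourhood all of
whose points are almost surely refuted by some prediction error. -/
theorem exists_nhds_ae_exists_lt [IsProbabilityMeasure P] (hCw : 0 < Cw) (hw : Noise P Cw w)
    (he : Admissible P Cu e) (hind : IndepOfPast P e w) (hf : Continuous (Function.uncurry f))
    (hf' : Continuous (Function.uncurry f')) (hm : 1 ≤ m) (hrec : Recurrent P f f' θ e w C)
    (hC₀ : DriftBound P f f' θ e w C C₀) {x : Vec n}
    (hx : ENNReal.ofReal (1 / Cw) < symLowerDensity (excitationSet f θ x)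
      fun _ : Fin m => Metric.closedBall (0 : Vec p) C₀) :
    ∃ U ∈ 𝓝 x, ∀ᵐ ω ∂P, ∀ x' ∈ U, ∃ s, m ≤ s ∧
      Cw < ‖w (s + 1) ω + (f θ (phi f f' θ e w s ω) - f x' (phi f f' θ e w s ω))‖ := by
  simp only [symLowerDensity, lt_iSup_iff] at hx
  obtain ⟨E, hE, hEd⟩ := hx
  choose F hFE hFfin hF using fun j =>
    exists_finite_of_lt_lowerDensity hCw (hEd.trans_le (iInf_le _ j))
  let G : Set (Fin m → Vec p) := Set.univ.pi F
  have hG : G.Finite := Set.Finite.pi fun j => hFfin j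
  let g : Vec n × (Fin m → Vec p) → Vec p := fun z =>
    f θ (WithLp.toLp 2 z.2) - f z.1 (WithLp.toLp 2 z.2)
  have hg : Continuous g := by
    have h1 : Continuous fun z : Vec n × (Fin m → Vec p) =>
        (WithLp.toLp 2 z.2 : Regressor p m) := (PiLp.continuous_toLp 2 _).comp continuous_snd
    exact (hf.comp (continuous_const.prodMk h1)).sub (hf.comp (continuous_fst.prodMk h1))
  have hv : ∀ η ∈ G, g (x, η) ≠ 0 := fun η hη =>
    sub_ne_zero.2 (hE (a := WithLp.toLp 2 η) fun j => hFE j (hη j trivial))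
  -- The same δ serves as the precision of the outputs and as the radius of the neighbourhood of x;
  -- the quarter is the tolerance of `lt_norm_add_of_near_extreme`.
  obtain ⟨δ, hδ, hδg⟩ := exists_pos_forall_dist_lt hg hG (fun η => (x, η))
    (ε := fun η => ‖g (x, η)‖ / 4)
    fun η hη => div_pos (norm_pos_iff.2 (hv η hη)) (by norm_num)
  refine ⟨Metric.ball x δ, Metric.ball_mem_nhds x hδ, ?_⟩
  let H : (Fin m → Vec p) → ℕ → Set Ω := fun η t =>
    {ω | ∀ j, dist (phi f f' θ e w (t + m) ω j) (η j) < δ}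
  have hH : ∀ η t, MeasurableSet[past e w (t + m + 1)] (H η t) := fun η t =>
    measurable_phi_past (t := t + m + 1) hf hf' (by omega)
      (IsOpen.measurableSet (s := {φ : Regressor p m | ∀ j, dist (φ j) (η j) < δ}) (by
        simp only [Set.ofPred_forall]
        exact isOpen_iInter_of_finite fun j => isOpen_lt (by fun_prop) continuous_const))
  have hstep : ∀ᵐ ω ∂P, ∀ η ∈ G, (∃ᶠ t in atTop, ω ∈ H η t) →
      ∃ᶠ t in atTop, ω ∈ H η t ∧ w (t + m + 1) ω ∈
        Metric.ball ((Cw / ‖g (x, η)‖) • g (x, η)) (‖g (x, η)‖ / 2) := by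
    refine (ae_ball_iff hG.countable).2 fun η hη =>
      hw.ae_frequently_mem_ball he hind m (hH η) ?_ (half_pos (norm_pos_iff.2 (hv η hη)))
    have := norm_pos_iff.2 (hv η hη)
    rw [mem_closedBall_zero_iff, norm_smul, Real.norm_of_nonneg (by positivity),
      div_mul_cancel₀ _ this.ne']
  -- The order is reversed because regressors list the newest output first: y_{t+i+1} is coordinate
  -- m - 1 - i of φ_{t+m}.
  have hnear := ae_frequently_outputs_near hw he hind hf hf' hrec hC₀
    (F := fun i => F ⟨m - 1 - i, by omega⟩) (fun i => hFfin _) (fun i => hF _) hδ le_rfl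
  filter_upwards [hnear, hstep] with ω hω hωstep
  have hex : ∃ᶠ t in atTop, ∃ η ∈ G, ω ∈ H η t := by
    refine hω.mono fun t ht => ?_
    have hj : ∀ j : Fin m, ∃ η ∈ F j, dist (phi f f' θ e w (t + m) ω j) η < δ := by
      intro j
      obtain ⟨η, hη, hd⟩ := ht.2 (m - 1 - j) (by omega)
      have hj' : (⟨m - 1 - (m - 1 - j), by omega⟩ : Fin m) = j := by ext; simp; omega
      have hidx : t + m - 1 - (j : ℕ) = t + (m - 1 - j) := by omega
      rw [hj'] at hη
      refine ⟨η, hη, ?_⟩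
      rw [phi_apply ω j (by omega), hidx]
      exact hd
    choose η hη hηd using hj
    exact ⟨η, fun j _ => hη j, hηd⟩
  obtain ⟨η, hη, hηf⟩ := exists_mem_frequently_of_frequently_exists_mem hG hex
  obtain ⟨t, htH, htw⟩ := (hωstep η hη hηf).exists
  intro x' hx'
  refine ⟨t + m, by omega, lt_norm_add_of_near_extreme hCw.le (hv η hη) ?_ htw⟩
  exact hδg η hη (x', WithLp.ofLp (phi f f' θ e w (t + m) ω))
    (max_lt hx' ((dist_pi_lt_iff hδ).2 htH))

end Elimination

end ControlSystem

/-! ### The drift bound and identifiability -/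

theorem theorem2p1 {Ω : Type*} [MeasurableSpace Ω] (P : Measure Ω) [IsProbabilityMeasure P]
    {n r p m : ℕ} (hm : 1 ≤ m)
    (a b : Fin n → ℝ) (hab : ∀ i, a i < b i)
    (f : ControlSystem.Vec n → ControlSystem.Regressor p m → ControlSystem.Vec p)
    (f' : ControlSystem.Vec r → ControlSystem.Regressor p m → ControlSystem.Vec p)
    (hf : Continuous (Function.uncurry f)) (hf' : Continuous (Function.uncurry f'))
    (Cw Cu C : ℝ) (hCw : 0 < Cw) (hCu : 0 < Cu) (hC : 0 < C)
    (w : ℕ → Ω → ControlSystem.Vec p) (hw : ControlSystem.Noise P Cw w)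
    (e : ControlSystem.Vec n → ControlSystem.Experiment Ω r p m)
    (he : ∀ θ ∈ ControlSystem.hyperrectangle a b, ControlSystem.Admissible P Cu (e θ))
    (hindep : ∀ θ ∈ ControlSystem.hyperrectangle a b, ControlSystem.IndepOfPast P (e θ) w)
    (hrec : ∀ θ ∈ ControlSystem.hyperrectangle a b,
      ControlSystem.Recurrent P f f' θ (e θ) w C) :
    (∃ C₀ : ℝ, 0 < C₀ ∧ ∀ θ ∈ ControlSystem.hyperrectangle a b,
      ControlSystem.DriftBound P f f' θ (e θ) w C C₀) ∧
    ∀ C₀ : ℝ, 0 < C₀ →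
      (∀ θ ∈ ControlSystem.hyperrectangle a b,
        ControlSystem.DriftBound P f f' θ (e θ) w C C₀) →
      (∀ x ∈ ControlSystem.hyperrectangle a b, ∀ x' ∈ ControlSystem.hyperrectangle a b, x ≠ x' →
        ENNReal.ofReal (1 / Cw) <
          ControlSystem.symLowerDensity (ControlSystem.excitationSet f x x')
            (fun _ : Fin m => Metric.closedBall (0 : ControlSystem.Vec p) C₀)) →
      ControlSystem.Identifiable P (ControlSystem.hyperrectangle a b) f f' e w := by
  have hΘ := ControlSystem.isCompact_hyperrectangle a b
  constructor
  · obtain ⟨C₀, hpos, h⟩ := ControlSystem.exists_norm_drift_le hΘ hf hf' Cu Cw C m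
    refine ⟨C₀, hpos, fun θ hθ => ?_⟩
    have hu : ∀ᵐ ω ∂P, ∀ t, 1 ≤ t → ‖(e θ).input t ω‖ ≤ Cu :=
      ae_all_iff.2 fun t => eventually_imp_distrib_left.2 fun ht => (he θ hθ).bounded t ht
    filter_upwards [hu, hw.ae_norm_le] with ω hωu hωw
    exact h θ hθ (e θ) w ω hωu hωw
  · intro C₀ _ hdrift hdens
    refine ControlSystem.identifiable_of_ae_exists_lt hΘ
      ⟨WithLp.toLp 2 a, fun i => ⟨le_rfl, (hab i).le⟩⟩ hf hf' hw.ae_norm_le fun θ hθ => ?_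
    have hloc : ∀ x ∈ ControlSystem.hyperrectangle a b \ {θ}, ∃ U ∈ 𝓝 x, ∀ᵐ ω ∂P, ∀ x' ∈ U,
        ∃ s, m ≤ s ∧ Cw < ‖w (s + 1) ω + (f θ (ControlSystem.phi f f' θ (e θ) w s ω) -
          f x' (ControlSystem.phi f f' θ (e θ) w s ω))‖ := fun x hx =>
      ControlSystem.exists_nhds_ae_exists_lt hCw hw (he θ hθ) (hindep θ hθ) hf hf' hm (hrec θ hθ)
        (hdrift θ hθ) (hdens θ hθ x hx.1 (Ne.symm hx.2))
    choose! U hU hUae using hloc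
    -- Each neighbourhood has its own null set, and there are uncountably many x; a countable
    -- subcover (Lindelöf) leaves a countable union of null sets.
    obtain ⟨T, hTsub, hTcount, hTcover⟩ := TopologicalSpace.countable_cover_nhdsWithin
      fun x hx => mem_nhdsWithin_of_mem_nhds (hU x hx)
    filter_upwards [(ae_ball_iff hTcount).2 fun x hx => hUae x (hTsub hx)] with ω hω x hx hxθ
    obtain ⟨x₀, hx₀, hxU⟩ := Set.mem_iUnion₂.1 (hTcover ⟨hx, hxθ⟩)
    exact hω x₀ hx₀ x hxU
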